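/- Let $N\ge 1$, $\gamma>0$, $\beta>0$, $\alpha>0$ and $\sigma N=4$. Let $H^2(\mathbb R^N)$ be the Sobolev space of complex-valued functions with norm $\|u\|^2=\int_{\mathbb R^N}|\Delta u|^2+|\nabla u|^2+|u|^2\,dx$, and for $u\in H^2(\mathbb R^N)$ put $$E(u)=\frac{\gamma}{2}\int_{\mathbb R^N}|\Delta u|^2\,dx-\frac{\beta}{2}\int_{\mathbb R^N}|\nabla u|^2\,dx-\frac{\alpha}{2\sigma+2}\int_{\mathbb R^N}|u|^{2\sigma+2}\,dx.$$ For $c>0$ let $$S(c)=\Big\{u\in H^2(\mathbb R^N):\int_{\mathbb R^N}|u|^2\,dx=c\Big\},\qquad m(c)=\inf_{u\in S(c)}E(u)\in[-\infty,+\infty).$$ Let $B_N(\tfrac4N)$ be the smallest constant $B$ for which the Gagliardo--Nirenberg inequality $$\|u\|_{2+8/N}^{2+8/N}\le B\,\|\Delta u\|_2^{2}\,\|u\|_2^{8/N}\qquad\text{for all }u\in H^2(\mathbb R^N)$$ holds (in particular, such a smallest constant exists), and set $$c_N^*=\left(\frac{\gamma}{\alpha}\cdot\frac{N+4}{N\,B_N(\frac4N)}\right)^{N/4}.$$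 Then $c_N^*\in(0,\infty)$, and: 1. if $0<c<c_N^*$, then $m(c)\in(-\infty,0)$ and $E$ is coercive on $S(c)$, that is, $E(u)\to+\infty$ as $\|u\|\to\infty$ with $u\in S(c)$; 2. if $c\ge c_N^*$, then $m(c)=-\infty$. -/

import Mathlib

open MeasureTheory
open scoped SchwartzMap LineDeriv Laplacian ENNReal

noncomputable section

namespace BiharmonicNLS

/-- Euclidean space `ℝ^N`. -/
abbrev Space (N : ℕ) : Type := EuclideanSpace ℝ (Fin N)

/-- Complex-valued `L²(ℝ^N)`, with Lebesgue measure. -/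
abbrev L2 (N : ℕ) : Type := Lp ℂ 2 (volume : Measure (Space N))

/-- The tempered distribution given by an `L²` function. -/
abbrev toDist {N : ℕ} (u : L2 N) : 𝓢'(Space N, ℂ) :=
  Lp.toTemperedDistribution u

/-- The Sobolev space `H²(ℝ^N)`, as a set of (classes of) complex-valued `L²` functions. -/
def H2 (N : ℕ) : Set (L2 N) :=
  {u | TemperedDistribution.MemSobolev 2 2 (toDist u)}

open Classical in
/-- The `L²` function representing a tempered distribution (it is unique if it exists; the
value is `0` if there is none). -/
def l2Rep {N : ℕ} (f : 𝓢'(Space N, ℂ)) : L2 N :=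
  if h : ∃ g : L2 N, f = toDist g then h.choose else 0

/-- The `i`-th distributional partial derivative of `u`, as an `L²` function. -/
def partialDeriv {N : ℕ} (i : Fin N) (u : L2 N) : L2 N :=
  l2Rep (∂_{EuclideanSpace.single i (1 : ℝ)} (toDist u))

/-- The distributional Laplacian of `u`, as an `L²` function. -/
def lap {N : ℕ} (u : L2 N) : L2 N :=
  l2Rep (Δ (toDist u))

theorem toDist_l2Rep {N : ℕ} {f : 𝓢'(Space N, ℂ)} (h : ∃ g : L2 N, f = toDist g) :
    toDist (l2Rep f) = f := by
  rw [l2Rep, dif_pos h]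
  exact h.choose_spec.symm

/-- For `u ∈ H²` the Laplacian really is represented by `lap u`. -/
theorem toDist_lap {N : ℕ} {u : L2 N} (hu : u ∈ H2 N) : toDist (lap u) = Δ (toDist u) := by
  apply toDist_l2Rep
  have h := TemperedDistribution.MemSobolev.laplacian hu
  rw [sub_self] at h
  exact TemperedDistribution.memSobolev_zero_iff.mp h

/-- For `u ∈ H²` the partial derivatives really are represented by `partialDeriv i u`. -/
theorem toDist_partialDeriv {N : ℕ} {u : L2 N} (hu : u ∈ H2 N) (i : Fin N) :
    toDist (partialDeriv i u) = ∂_{EuclideanSpace.single i (1 : ℝ)} (toDist u) := by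
  apply toDist_l2Rep
  have h := TemperedDistribution.MemSobolev.lineDerivOp (m := EuclideanSpace.single i (1 : ℝ)) hu
  exact TemperedDistribution.memSobolev_zero_iff.mp
    (TemperedDistribution.MemSobolev.mono (by norm_num) h)

/-- `|∇u(x)|²`. -/
def gradSq {N : ℕ} (u : L2 N) (x : Space N) : ℝ :=
  ∑ i, ‖partialDeriv i u x‖ ^ 2

/-- The norm of `H²(ℝ^N)`: `‖u‖² = ∫ |Δu|² + |∇u|² + |u|²`. -/
def h2Norm {N : ℕ} (u : L2 N) : ℝ :=
  Real.sqrt (∫ x, (‖lap u x‖ ^ 2 + gradSq u x + ‖u x‖ ^ 2))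

/-- The sphere `S(c) = {u ∈ H² : ∫ |u|² = c}`. -/
def S (N : ℕ) (c : ℝ) : Set (L2 N) :=
  {u | u ∈ H2 N ∧ ∫ x, ‖u x‖ ^ 2 = c}

/-- The energy
`E(u) = (γ/2) ∫ |Δu|² - (β/2) ∫ |∇u|² - (α/(2σ+2)) ∫ |u|^(2σ+2)`. -/
def energy {N : ℕ} (γ β α σ : ℝ) (u : L2 N) : ℝ :=
  γ / 2 * (∫ x, ‖lap u x‖ ^ 2) - β / 2 * (∫ x, gradSq u x)
    - α / (2 * σ + 2) * ∫ x, ‖u x‖ ^ (2 * σ + 2)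

/-- `m(c) = inf {E(u) : u ∈ S(c)}`, in the extended reals. -/
def m (N : ℕ) (γ β α σ c : ℝ) : EReal :=
  ⨅ u ∈ S N c, (energy γ β α σ u : EReal)

/-- The admissible constants `B` in the Gagliardo-Nirenberg inequality
`‖u‖_{2σ+2}^{2σ+2} ≤ B ‖Δu‖_2^{σN/2} ‖u‖_2^{2+2σ-σN/2}` for all `u ∈ H²(ℝ^N)`
(in particular the left-hand side is finite). Here `‖·‖` on `L2 N` is the `L²` norm. -/
def gnConstants (N : ℕ) (σ : ℝ) : Set ℝ :=
  {B | ∀ u ∈ H2 N, MemLp u (ENNReal.ofReal (2 * σ + 2)) volume ∧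
    ∫ x, ‖u x‖ ^ (2 * σ + 2) ≤
      B * ‖lap u‖ ^ (σ * N / 2) * ‖u‖ ^ (2 + 2 * σ - σ * N / 2)}

/-- The best constant `B_N(σ)` in the Gagliardo-Nirenberg inequality. -/
def gnBest (N : ℕ) (σ : ℝ) : ℝ :=
  sInf (gnConstants N σ)

/-- The critical mass `c*_N = ((γ/α) C(N))^(N/4)`, where `C(N) = (N+4) / (N B_N(4/N))`. -/
def cStar (N : ℕ) (γ α : ℝ) : ℝ :=
  (γ / α * ((N + 4) / (N * gnBest N (4 / N)))) ^ ((N : ℝ) / 4)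

/-- `F` is coercive on `A ⊆ H²`: `F(u) → +∞` as `‖u‖ → ∞` in the `H²` norm, `u ∈ A`. -/
def CoerciveOn {N : ℕ} (F : L2 N → ℝ) (A : Set (L2 N)) : Prop :=
  ∀ M : ℝ, ∃ R : ℝ, ∀ u ∈ A, R ≤ h2Norm u → M ≤ F u

end BiharmonicNLS

end

noncomputable section

namespace BiharmonicNLS

open FourierTransform TemperedDistribution

variable {N : ℕ}

/-! Since `σ * N = 4`, the mass-preserving dilation by `r` multiplies both `‖Δu‖²` and `∫
|u|^(2+8/N)` by `r⁴`, but `∫ |∇u|²` only by `r²`. On a dilation orbit the energy is thus `r⁴ X - r²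
Y` with `Y > 0` (`energy_dilate`), and small `r` makes it negative at every mass.

The Gagliardo-Nirenberg inequality with best constant gives `X ≥ κ ‖Δu‖²` on `S(c)`, with `κ > 0`
exactly when `c < c*` (`lt_cStar_iff`). Interpolating the gradient between `‖Δu‖` and `‖u‖` then
costs only part of `κ`, whence boundedness below and coercivity (`exists_energy_ge`).

If `c ≥ c*`, near-optimizers normalized by `‖Δv‖ = 1` have `X` at most as small a positive number as
desired. Their gradients are bounded below uniformly (`exists_gradient_lower_bound`), so a large
dilation sends the energy to `-∞`. No optimizer is needed, even at `c = c*`.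

The Gagliardo-Nirenberg inequality itself is proved by the layer-cake formula, cutting frequencies
at a radius that depends on the level (`gagliardo_nirenberg_fourier`). -/

/-! ### Fourier description of `H²`, the Laplacian and the gradient. -/

theorem toDist_injective : Function.Injective (toDist : L2 N → 𝓢'(Space N, ℂ)) := by
  have h := Lp.ker_toTemperedDistributionCLM_eq_bot (E := Space N) (F := ℂ)
    (μ := (volume : Measure (Space N))) (p := 2)
  exact LinearMap.ker_eq_bot.mp h

/-- An `L²` function representing the product of a symbol of temperate growth with an `L²`
function is almost everywhere equal to the pointwise product. -/
theorem toDist_eq_smulLeft_iff {h : Space N → ℂ} (hh : h.HasTemperateGrowth) (f g : L2 N) :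
    toDist g = smulLeftCLM ℂ h (toDist f) ↔ g =ᵐ[volume] fun ξ => h ξ * f ξ := by
  constructor
  · intro H
    have hloc : LocallyIntegrable (fun ξ => h ξ * f ξ) (volume : Measure (Space N)) :=
      locallyIntegrable_iff.2 fun K hK => IntegrableOn.continuousOn_mul
        hh.1.continuous.continuousOn
        (((Lp.memLp f).locallyIntegrable (by norm_num)).integrableOn_isCompact hK) hK
    have hg : LocallyIntegrable g (volume : Measure (Space N)) :=
      (Lp.memLp g).locallyIntegrable (by norm_num)
    refine ae_eq_of_integral_contDiff_smul_eq hg hloc fun φ hφ hc => ?_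
    have hg₁ : HasCompactSupport (Complex.ofRealCLM ∘ φ) := hc.comp_left rfl
    have hg₂ : ContDiff ℝ (⊤ : ℕ∞) (Complex.ofRealCLM ∘ φ) := by fun_prop
    have := DFunLike.congr_fun H (hg₁.toSchwartzMap hg₂)
    simp [hh] at this
    simp only [Complex.real_smul]
    rw [this]
    congr 1
    ext; ring
  · intro H
    ext φ
    simp only [Lp.toTemperedDistribution_apply, smulLeftCLM_apply_apply]
    apply integral_congr_ae
    filter_upwards [H] with ξ hξ
    simp [hh, hξ]; ring

theorem mem_H2_iff (u : L2 N) :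
    u ∈ H2 N ↔ MemLp (fun ξ => ((1 + ‖ξ‖ ^ 2 : ℝ) : ℂ) * (𝓕 u : L2 N) ξ) 2 volume := by
  have hh : (fun ξ : Space N => (((1 + ‖ξ‖ ^ 2) ^ ((2:ℝ) / 2) : ℝ) : ℂ)).HasTemperateGrowth := by
    fun_prop
  have e : (fun ξ : Space N => (((1 + ‖ξ‖ ^ 2) ^ ((2:ℝ) / 2) : ℝ) : ℂ)) =
      fun ξ => ((1 + ‖ξ‖ ^ 2 : ℝ) : ℂ) := by
    ext; norm_num
  rw [e] at hh
  show MemSobolev 2 2 (toDist u) ↔ _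
  rw [memSobolev_iff_exists_smulLeftCLM_fourier, Lp.fourier_toTemperedDistribution_eq, e]
  constructor
  · rintro ⟨g, hg⟩
    exact (memLp_congr_ae ((toDist_eq_smulLeft_iff hh _ _).1 hg.symm)).1 (Lp.memLp g)
  · intro H
    exact ⟨H.toLp, ((toDist_eq_smulLeft_iff hh _ _).2 H.coeFn_toLp).symm⟩

theorem fourier_lap {u : L2 N} (hu : u ∈ H2 N) :
    (𝓕 (lap u) : L2 N) =ᵐ[volume]
      fun ξ => ((-(2 * Real.pi) ^ 2 * ‖ξ‖ ^ 2 : ℝ) : ℂ) * (𝓕 u : L2 N) ξ := by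
  rw [← toDist_eq_smulLeft_iff (by fun_prop), toDist, toDist,
    ← Lp.fourier_toTemperedDistribution_eq, ← Lp.fourier_toTemperedDistribution_eq]
  have := toDist_lap hu
  rw [toDist] at this
  rw [this, laplacian_eq_fourierMultiplierCLM, fourierMultiplierCLM_apply,
    ← Complex.coe_smul, fourier_smul, fourier_fourierInv_eq]
  have : (fun ξ : Space N => ((-(2 * Real.pi) ^ 2 * ‖ξ‖ ^ 2 : ℝ) : ℂ)) =
    ((-(2 * Real.pi) ^ 2 : ℝ) : ℂ) • fun ξ => ((‖ξ‖ ^ 2 : ℝ) : ℂ) := by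
    ext; simp
  rw [this, smulLeftCLM_smul (by fun_prop)]
  simp

theorem fourier_partialDeriv {u : L2 N} (hu : u ∈ H2 N) (i : Fin N) :
    (𝓕 (partialDeriv i u) : L2 N) =ᵐ[volume]
      fun ξ => (2 * Real.pi * Complex.I * (ξ i : ℂ)) * (𝓕 u : L2 N) ξ := by
  have e : (fun ξ : Space N => (2 * Real.pi * Complex.I * (ξ i : ℂ))) =
    (2 * Real.pi * Complex.I) • fun ξ => ((inner ℝ ξ (EuclideanSpace.single i (1 : ℝ)) : ℝ) : ℂ) := by
    ext; simp [EuclideanSpace.inner_single_right]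
  have ht : (fun ξ : Space N => (2 * Real.pi * Complex.I * (ξ i : ℂ))).HasTemperateGrowth := by
    rw [e]; exact (Function.HasTemperateGrowth.const _).smul (by fun_prop)
  rw [← toDist_eq_smulLeft_iff ht, toDist, toDist,
    ← Lp.fourier_toTemperedDistribution_eq, ← Lp.fourier_toTemperedDistribution_eq]
  have := toDist_partialDeriv hu i
  rw [toDist] at this
  rw [this, lineDeriv_eq_fourierMultiplierCLM, fourierMultiplierCLM_apply,
    fourier_smul, fourier_fourierInv_eq, e, smulLeftCLM_smul (by fun_prop)]
  simp

theorem norm_sq_eq_integral (u : L2 N) : ‖u‖ ^ 2 = ∫ x, ‖u x‖ ^ 2 := by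
  have h := L2.inner_def (𝕜 := ℂ) u u
  rw [inner_self_eq_norm_sq_to_K] at h
  have h2 : ∀ x, inner ℂ (u x) (u x) = ((‖u x‖ ^ 2 : ℝ) : ℂ) := fun x => by
    rw [inner_self_eq_norm_sq_to_K]; simp
  simp_rw [h2] at h
  rw [integral_complex_ofReal] at h
  exact Complex.ofReal_injective (by simpa using h)

theorem integrable_norm_sq (u : L2 N) : Integrable (fun x => ‖u x‖ ^ 2) volume :=
  (Lp.memLp u).integrable_norm_pow (by norm_num)

theorem norm_fourier_lap {u : L2 N} (hu : u ∈ H2 N) :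
    (fun ξ => ‖(𝓕 (lap u) : L2 N) ξ‖ ^ 2) =ᵐ[volume]
      fun ξ => (2 * Real.pi) ^ 4 * (‖ξ‖ ^ 4 * ‖(𝓕 u : L2 N) ξ‖ ^ 2) := by
  filter_upwards [fourier_lap hu] with ξ hξ
  rw [hξ, norm_mul, Complex.norm_real, mul_pow, Real.norm_eq_abs, sq_abs]
  ring

theorem integrable_norm_pow_four_mul {u : L2 N} (hu : u ∈ H2 N) :
    Integrable (fun ξ => ‖ξ‖ ^ 4 * ‖(𝓕 u : L2 N) ξ‖ ^ 2) volume := by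
  have h := (integrable_norm_sq (𝓕 (lap u))).congr (norm_fourier_lap hu)
  exact (integrable_const_mul_iff (by simp [Real.pi_ne_zero]) _).1 h

theorem norm_lap_sq {u : L2 N} (hu : u ∈ H2 N) :
    ‖lap u‖ ^ 2 = (2 * Real.pi) ^ 4 * ∫ ξ, ‖ξ‖ ^ 4 * ‖(𝓕 u : L2 N) ξ‖ ^ 2 := by
  rw [← Lp.norm_fourier_eq, norm_sq_eq_integral, integral_congr_ae (norm_fourier_lap hu),
    integral_const_mul]

theorem integrable_gradSq (u : L2 N) : Integrable (gradSq u) volume :=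
  integrable_finsetSum _ fun i _ => integrable_norm_sq (partialDeriv i u)

theorem sum_norm_fourier_partialDeriv {u : L2 N} (hu : u ∈ H2 N) :
    (fun ξ => ∑ i, ‖(𝓕 (partialDeriv i u) : L2 N) ξ‖ ^ 2) =ᵐ[volume]
      fun ξ => (2 * Real.pi) ^ 2 * (‖ξ‖ ^ 2 * ‖(𝓕 u : L2 N) ξ‖ ^ 2) := by
  have h : ∀ᵐ ξ : Space N, ∀ i, (𝓕 (partialDeriv i u) : L2 N) ξ =
      (2 * Real.pi * Complex.I * (ξ i : ℂ)) * (𝓕 u : L2 N) ξ :=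
    ae_all_iff.2 fun i => fourier_partialDeriv hu i
  filter_upwards [h] with ξ hξ
  simp only [hξ, norm_mul, mul_pow, EuclideanSpace.norm_sq_eq, Complex.norm_real, Complex.norm_I]
  rw [← Finset.sum_mul, ← Finset.mul_sum]
  simp [abs_of_pos Real.pi_pos]
  ring

theorem integrable_norm_sq_mul {u : L2 N} (hu : u ∈ H2 N) :
    Integrable (fun ξ => ‖ξ‖ ^ 2 * ‖(𝓕 u : L2 N) ξ‖ ^ 2) volume := by
  have h := (integrable_finsetSum Finset.univ
    fun i _ => integrable_norm_sq (𝓕 (partialDeriv i u))).congr (sum_norm_fourier_partialDeriv hu)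
  exact (integrable_const_mul_iff (by simp [Real.pi_ne_zero]) _).1 h

theorem integral_gradSq {u : L2 N} (hu : u ∈ H2 N) :
    ∫ x, gradSq u x = (2 * Real.pi) ^ 2 * ∫ ξ, ‖ξ‖ ^ 2 * ‖(𝓕 u : L2 N) ξ‖ ^ 2 := by
  rw [← integral_const_mul, ← integral_congr_ae (sum_norm_fourier_partialDeriv hu)]
  unfold gradSq
  rw [integral_finsetSum _ fun i _ => integrable_norm_sq _,
    integral_finsetSum _ fun i _ => integrable_norm_sq _]
  simp [← norm_sq_eq_integral]

theorem mem_H2_of_memLp {u : L2 N}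
    (h : MemLp (fun ξ => ((‖ξ‖ ^ 2 : ℝ) : ℂ) * (𝓕 u : L2 N) ξ) 2 volume) : u ∈ H2 N := by
  rw [mem_H2_iff]
  refine (memLp_congr_ae (.of_forall fun ξ => ?_)).1 ((Lp.memLp (𝓕 u : L2 N)).add h)
  simp; ring

theorem mem_H2_of_fourier_le {u v : L2 N} (hu : u ∈ H2 N)
    (h : ∀ᵐ ξ, ‖(𝓕 v : L2 N) ξ‖ ≤ ‖(𝓕 u : L2 N) ξ‖) : v ∈ H2 N := by
  rw [mem_H2_iff] at *
  refine hu.mono ?_ ?_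
  · exact (Continuous.aestronglyMeasurable (by fun_prop)).mul (Lp.aestronglyMeasurable _)
  · filter_upwards [h] with ξ hξ
    rw [norm_mul, norm_mul]
    gcongr

/-! ### Frequency cut-offs. -/

/-- On `L¹ ∩ L²` the inverse Fourier transform is bounded by the `L¹` norm. -/
theorem norm_fourierInv_le (g : L2 N) (hg : Integrable g volume) :
    ∀ᵐ x, ‖(𝓕⁻ g : L2 N) x‖ ≤ ∫ ξ, ‖g ξ‖ := by
  -- The `L²` inverse transform agrees with the Fourier integral: tested against smooth compactly
  -- supported functions, both move the transform onto the test function.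
  have key : (𝓕⁻ g : L2 N) =ᵐ[volume] 𝓕⁻ (g : Space N → ℂ) := by
    have hc : Continuous (𝓕⁻ (g : Space N → ℂ)) := by
      have : 𝓕⁻ (g : Space N → ℂ) = fun x => 𝓕 (g : Space N → ℂ) (-x) := by
        ext x; rw [Real.fourierInv_eq_fourier_neg]
      rw [this]
      exact (VectorFourier.fourierIntegral_continuous Real.continuous_fourierChar
        (by exact continuous_inner) hg).comp continuous_neg
    refine ae_eq_of_integral_contDiff_smul_eq ((Lp.memLp _).locallyIntegrable (by norm_num))
      hc.locallyIntegrable fun φ hφ hφc => ?_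
    have hg₁ : HasCompactSupport (Complex.ofRealCLM ∘ φ) := hφc.comp_left rfl
    have hg₂ : ContDiff ℝ (⊤ : ℕ∞) (Complex.ofRealCLM ∘ φ) := by fun_prop
    set Φ : 𝓢(Space N, ℂ) := hg₁.toSchwartzMap hg₂
    have h1 := DFunLike.congr_fun (Lp.fourierInv_toTemperedDistribution_eq g) Φ
    rw [fourierInv_apply, Lp.toTemperedDistribution_apply, Lp.toTemperedDistribution_apply] at h1
    have h2 : ∫ ξ, (𝓕⁻ Φ : 𝓢(Space N, ℂ)) ξ • g ξ = ∫ x, Φ x • 𝓕⁻ (g : Space N → ℂ) x := by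
      rw [SchwartzMap.fourierInv_coe]
      have h3 := VectorFourier.integral_fourierIntegral_smul_eq_flip (μ := volume) (ν := volume)
        (L := -innerₗ (Space N)) Real.continuous_fourierChar
        (by exact continuous_inner.neg) Φ.integrable hg
      have h4 : ∀ f : Space N → ℂ,
          𝓕⁻ f = VectorFourier.fourierIntegral Real.fourierChar volume (-innerₗ (Space N)) f := by
        intro f; ext ξ
        simp [Real.fourierInv_eq, VectorFourier.fourierIntegral]
      have h5 : (-innerₗ (Space N)).flip = -innerₗ (Space N) := by
        ext x y; simp [real_inner_comm]
      rw [h5, ← h4, ← h4] at h3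
      exact h3
    rw [h2] at h1
    simpa [Φ] using h1.symm
  filter_upwards [key] with x hx
  rw [hx, Real.fourierInv_eq]
  refine (norm_integral_le_integral_norm _).trans (le_of_eq ?_)
  simp

/-- The sharp frequency cut-off of an `L²` function to the set `s`. -/
def freqCut {s : Set (Space N)} (hs : MeasurableSet s) (u : L2 N) : L2 N :=
  𝓕⁻ (((Lp.memLp (𝓕 u : L2 N)).indicator hs).toLp _)

theorem fourier_freqCut {s : Set (Space N)} (hs : MeasurableSet s) (u : L2 N) :
    (𝓕 (freqCut hs u) : L2 N) =ᵐ[volume] s.indicator (𝓕 u : L2 N) := by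
  rw [freqCut, fourier_fourierInv_eq]
  exact MemLp.coeFn_toLp _

theorem freqCut_add_compl {s : Set (Space N)} (hs : MeasurableSet s) (u : L2 N) :
    freqCut hs u + freqCut hs.compl u = u := by
  rw [freqCut, freqCut, ← fourierInv_add]
  conv_rhs => rw [← fourierInv_fourier_eq (F := L2 N) u]
  congr 1
  apply Lp.ext
  filter_upwards [Lp.coeFn_add (((Lp.memLp (𝓕 u : L2 N)).indicator hs).toLp _)
      (((Lp.memLp (𝓕 u : L2 N)).indicator hs.compl).toLp _),
    ((Lp.memLp (𝓕 u : L2 N)).indicator hs).coeFn_toLp,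
    ((Lp.memLp (𝓕 u : L2 N)).indicator hs.compl).coeFn_toLp] with x h1 h2 h3
  rw [h1, Pi.add_apply, h2, h3, Set.indicator_self_add_compl_apply]

theorem freqCut_mem_H2 {s : Set (Space N)} (hs : MeasurableSet s) {u : L2 N} (hu : u ∈ H2 N) :
    freqCut hs u ∈ H2 N := by
  refine mem_H2_of_fourier_le hu ?_
  filter_upwards [fourier_freqCut hs u] with ξ hξ
  rw [hξ]
  exact norm_indicator_le_norm_self _ _

theorem norm_fourier_freqCut_sq {s : Set (Space N)} (hs : MeasurableSet s) (u : L2 N) :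
    (fun ξ => ‖(𝓕 (freqCut hs u) : L2 N) ξ‖ ^ 2) =ᵐ[volume]
      s.indicator fun ξ => ‖(𝓕 u : L2 N) ξ‖ ^ 2 := by
  filter_upwards [fourier_freqCut hs u] with ξ hξ
  rw [hξ]
  by_cases h : ξ ∈ s <;> simp [h]

/-- Bernstein's inequality: Cauchy-Schwarz on `s` bounds the `L¹` norm of the truncated transform,
and Plancherel returns `‖u‖`. -/
theorem norm_freqCut_le {s : Set (Space N)} (hs : MeasurableSet s) (hfin : volume s ≠ ∞)
    (u : L2 N) : ∀ᵐ x, ‖freqCut hs u x‖ ≤ Real.sqrt (volume.real s) * ‖u‖ := by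
  set f : L2 N := 𝓕 u with hf
  have hm := (Lp.memLp f).indicator hs
  have : IsFiniteMeasure (volume.restrict s) := ⟨by simpa using hfin.lt_top⟩
  have hfs : Integrable f (volume.restrict s) :=
    memLp_one_iff_integrable.1 (((Lp.memLp f).restrict s).mono_exponent (by norm_num))
  have hint : Integrable (hm.toLp _) volume :=
    ((integrable_indicator_iff hs).2 hfs).congr hm.coeFn_toLp.symm
  have hb : ∫ ξ, ‖hm.toLp _ ξ‖ ≤ Real.sqrt (volume.real s) * ‖u‖ := by
    have e1 : ∫ ξ, ‖hm.toLp _ ξ‖ = ∫ ξ in s, ‖f ξ‖ := by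
      rw [← integral_indicator hs]
      refine integral_congr_ae ?_
      filter_upwards [hm.coeFn_toLp] with ξ hξ
      rw [hξ, norm_indicator_eq_indicator_norm]
    rw [e1, integral_norm_eq_lintegral_enorm hfs.1, ← eLpNorm_one_eq_lintegral_enorm]
    have h2 := eLpNorm_le_eLpNorm_mul_rpow_measure_univ (p := 1) (q := 2) (by norm_num) hfs.1
    have h3 : eLpNorm f 2 (volume.restrict s) ≤ eLpNorm f 2 volume :=
      eLpNorm_mono_measure _ Measure.restrict_le_self
    have h4 : eLpNorm f 1 (volume.restrict s) ≤ eLpNorm f 2 volume * volume s ^ (1 / 2 : ℝ) := by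
      refine h2.trans ?_
      rw [Measure.restrict_apply_univ]
      norm_num
      gcongr
    have h5 := ENNReal.toReal_mono
      (ENNReal.mul_ne_top (Lp.eLpNorm_ne_top f) (ENNReal.rpow_ne_top_of_nonneg (by norm_num) hfin)) h4
    rw [ENNReal.toReal_mul, ← ENNReal.toReal_rpow, ← Real.sqrt_eq_rpow, ← Lp.norm_def,
      hf, Lp.norm_fourier_eq, mul_comm] at h5
    exact h5
  filter_upwards [norm_fourierInv_le _ hint] with x hx
  exact hx.trans hb

/-- Chebyshev's inequality for the high frequencies. -/
theorem volume_lt_norm_le {s : Set (Space N)} (hs : MeasurableSet s) (hfin : volume s ≠ ∞)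
    (u : L2 N) {t : ℝ} (ht : 0 < t) (hst : Real.sqrt (volume.real s) * ‖u‖ ≤ t / 2) :
    volume {x | t < ‖u x‖} ≤ ENNReal.ofReal (4 / t ^ 2) *
      ∫⁻ ξ, (sᶜ).indicator (fun ξ => ENNReal.ofReal (‖(𝓕 u : L2 N) ξ‖ ^ 2)) ξ := by
  -- The low-frequency part is at most `t / 2`, so where `|u| > t` the high-frequency part exceeds
  -- `t / 2`.
  have hle : volume {x | t < ‖u x‖} ≤
      volume {x | ENNReal.ofReal ((t / 2) ^ 2) ≤ ENNReal.ofReal (‖freqCut hs.compl u x‖ ^ 2)} := by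
    refine measure_mono_ae ?_
    have hadd := Lp.coeFn_add (freqCut hs u) (freqCut hs.compl u)
    rw [freqCut_add_compl] at hadd
    filter_upwards [norm_freqCut_le hs hfin u, hadd] with x h1 h2 h3
    have h3 : t < ‖u x‖ := h3
    rw [h2, Pi.add_apply] at h3
    have := norm_add_le (freqCut hs u x) (freqCut hs.compl u x)
    refine ENNReal.ofReal_le_ofReal ?_
    have : t / 2 ≤ ‖freqCut hs.compl u x‖ := by linarith
    gcongr
  have hch := mul_meas_ge_le_lintegral (μ := (volume : Measure (Space N)))
    (f := fun x => ENNReal.ofReal (‖freqCut hs.compl u x‖ ^ 2))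
    ((Lp.stronglyMeasurable _).measurable.norm.pow_const 2).ennreal_ofReal
    (ENNReal.ofReal ((t / 2) ^ 2))
  have hI : ∫⁻ x, ENNReal.ofReal (‖freqCut hs.compl u x‖ ^ 2) =
      ∫⁻ ξ, (sᶜ).indicator (fun ξ => ENNReal.ofReal (‖(𝓕 u : L2 N) ξ‖ ^ 2)) ξ := by
    rw [← ofReal_integral_eq_lintegral_ofReal (integrable_norm_sq _)
      (.of_forall fun x => sq_nonneg _), ← norm_sq_eq_integral, ← Lp.norm_fourier_eq,
      norm_sq_eq_integral, ofReal_integral_eq_lintegral_ofReal (integrable_norm_sq _)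
      (.of_forall fun x => sq_nonneg _)]
    refine lintegral_congr_ae ?_
    filter_upwards [norm_fourier_freqCut_sq hs.compl u] with ξ hξ
    rw [hξ]
    by_cases h : ξ ∈ s <;> simp [h]
  rw [hI] at hch
  refine hle.trans ?_
  have e : ENNReal.ofReal (4 / t ^ 2) * ENNReal.ofReal ((t / 2) ^ 2) = 1 := by
    rw [← ENNReal.ofReal_mul (by positivity), ← ENNReal.ofReal_one]
    congr 1; field_simp; norm_num
  calc _ = ENNReal.ofReal (4 / t ^ 2) * (ENNReal.ofReal ((t / 2) ^ 2) *
        volume {x | ENNReal.ofReal ((t / 2) ^ 2) ≤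
          ENNReal.ofReal (‖freqCut hs.compl u x‖ ^ 2)}) := by rw [← mul_assoc, e, one_mul]
    _ ≤ _ := by gcongr

/-! ### The Gagliardo-Nirenberg inequality. -/

theorem lintegral_rpow_Ioo {q W : ℝ} (hq : 0 < q) (hW : 0 ≤ W) :
    ∫⁻ t in Set.Ioo 0 W, ENNReal.ofReal (4 * t ^ (q - 1)) = ENNReal.ofReal (4 / q * W ^ q) := by
  have hi : IntegrableOn (fun t : ℝ => 4 * t ^ (q - 1)) (Set.Ioo 0 W) volume := by
    have := (intervalIntegral.intervalIntegrable_rpow' (a := 0) (b := W)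
      (show -1 < q - 1 by linarith)).const_mul 4
    rw [intervalIntegrable_iff_integrableOn_Ioo_of_le hW] at this
    exact this
  rw [← ofReal_integral_eq_lintegral_ofReal hi]
  · congr 1
    rw [← integral_Ioc_eq_integral_Ioo, ← intervalIntegral.integral_of_le hW,
      intervalIntegral.integral_const_mul, integral_rpow (Or.inl (by linarith))]
    simp [Real.zero_rpow hq.ne']
    ring
  · filter_upwards [ae_restrict_mem measurableSet_Ioo] with t ht
    have := ht.1.le
    positivity

theorem closedBall_eq_weight_le (hN : 1 ≤ N) {a t : ℝ} (ha : 0 < a) (ht : 0 ≤ t) :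
    {ξ : Space N | a * ‖ξ‖ ^ ((N : ℝ) / 2) ≤ t} = Metric.closedBall 0 ((t / a) ^ ((2 : ℝ) / N)) := by
  have hN' : (0 : ℝ) < N := by exact_mod_cast hN
  ext ξ
  rw [Set.mem_ofPred_eq, mem_closedBall_zero_iff, mul_comm, ← le_div_iff₀ ha]
  have e : (t / a) = ((t / a) ^ ((2 : ℝ) / N)) ^ ((N : ℝ) / 2) := by
    rw [← Real.rpow_mul (by positivity), show (2 : ℝ) / N * (N / 2) = 1 by field_simp,
      Real.rpow_one]
  conv_lhs => rw [e]
  exact Real.rpow_le_rpow_iff (norm_nonneg _) (by positivity) (by positivity)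

/-- The Gagliardo-Nirenberg inequality, with the Laplacian on the Fourier side. -/
theorem gagliardo_nirenberg_fourier (hN : 1 ≤ N) :
    ∃ C : ℝ, 0 ≤ C ∧ ∀ u ∈ H2 N, ∫⁻ x, ENNReal.ofReal (‖u x‖ ^ (2 + 8 / N : ℝ)) ≤
      ENNReal.ofReal (C * ‖u‖ ^ (8 / N : ℝ) * ∫ ξ, ‖ξ‖ ^ 4 * ‖(𝓕 u : L2 N) ξ‖ ^ 2) := by
  have hN' : (0 : ℝ) < N := by exact_mod_cast hN
  set q : ℝ := 8 / N with hq
  have hq0 : 0 < q := by positivity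
  set K : ℝ := Real.sqrt (volume.real (Metric.closedBall (0 : Space N) 1)) with hK
  have hK0 : 0 < K := Real.sqrt_pos.2 (ENNReal.toReal_pos
    (Metric.measure_closedBall_pos _ _ one_pos).ne' measure_closedBall_lt_top.ne)
  refine ⟨(2 + q) * (4 / q) * (2 * K) ^ q, by positivity, fun u hu => ?_⟩
  rcases eq_or_ne u 0 with rfl | hne
  · have : ∫⁻ x, ENNReal.ofReal (‖(0 : L2 N) x‖ ^ (2 + q)) = 0 := by
      rw [← lintegral_zero (μ := (volume : Measure (Space N)))]
      refine lintegral_congr_ae ?_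
      filter_upwards [Lp.coeFn_zero ℂ 2 (volume : Measure (Space N))] with x hx
      rw [hx]
      simp [Real.zero_rpow (show 2 + q ≠ 0 by positivity)]
    rw [this]; exact zero_le
  have hu0 : 0 < ‖u‖ := norm_pos_iff.2 hne
  -- With this `a`, the ball `W ≤ t` has measure `(t K / a)²`, which makes the Bernstein bound of
  -- the low frequencies exactly `t / 2`.
  set a : ℝ := 2 * K * ‖u‖ with ha
  have ha0 : 0 < a := by positivity
  set f : L2 N := 𝓕 u with hf
  have hfm : Measurable f := (Lp.stronglyMeasurable f).measurable
  -- The power `N / 2` makes the volume of `W ≤ t` quadratic in `t`, and `W ^ q` a multiple of `‖ξ‖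
  -- ^ 4`.
  set W : Space N → ℝ := fun ξ => a * ‖ξ‖ ^ ((N : ℝ) / 2) with hW
  have hW0 : ∀ ξ, 0 ≤ W ξ := fun ξ => by positivity
  have hWm : Measurable W := (measurable_norm.pow_const _).const_mul _
  have hmeas : ∀ t, MeasurableSet {ξ | W ξ ≤ t} := fun t => measurableSet_le hWm measurable_const
  have hlevel : ∀ t ∈ Set.Ioi (0 : ℝ),
      volume {x | t < ‖u x‖} * ENNReal.ofReal (t ^ (2 + q - 1)) ≤
      ∫⁻ ξ, {z : ℝ × Space N | z.1 < W z.2}.indicator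
        (fun z => ENNReal.ofReal (4 * z.1 ^ (q - 1)) * ENNReal.ofReal (‖f z.2‖ ^ 2)) (t, ξ) := by
    intro t ht
    have ht : 0 < t := ht
    have hball := closedBall_eq_weight_le hN ha0 ht.le
    have hvol : volume.real {ξ | W ξ ≤ t} = (t / a * K) ^ 2 := by
      rw [hball, Measure.addHaar_real_closedBall' _ _ (by positivity), mul_pow, hK,
        Real.sq_sqrt measureReal_nonneg, finrank_euclideanSpace_fin, ← Real.rpow_natCast,
        ← Real.rpow_mul (by positivity)]
      congr 1
      rw [div_mul_cancel₀ _ hN'.ne']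
      norm_cast
    have h1 := volume_lt_norm_le (hmeas t) (by rw [hball]; exact measure_closedBall_lt_top.ne)
      u ht (le_of_eq (by
        rw [hvol, Real.sqrt_sq (by positivity), ha]; field_simp))
    calc _ ≤ _ := mul_le_mul_left h1 _
      _ = ENNReal.ofReal (4 * t ^ (q - 1)) * ∫⁻ ξ, ({ξ | W ξ ≤ t}ᶜ).indicator
          (fun ξ => ENNReal.ofReal (‖f ξ‖ ^ 2)) ξ := by
        rw [mul_right_comm, ← ENNReal.ofReal_mul (by positivity)]
        congr 2
        rw [show (2 + q - 1) = (q - 1) + (2 : ℕ) by push_cast; ring,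
          Real.rpow_add_natCast ht.ne']
        field_simp
      _ = _ := by
        rw [← lintegral_const_mul]
        · refine lintegral_congr fun ξ => ?_
          by_cases h : W ξ ≤ t <;> simp [h, Set.indicator]
        · exact ((hfm.norm.pow_const 2).ennreal_ofReal).indicator (hmeas t).compl
  have hFm : Measurable ({z : ℝ × Space N | z.1 < W z.2}.indicator
      (fun z => ENNReal.ofReal (4 * z.1 ^ (q - 1)) * ENNReal.ofReal (‖f z.2‖ ^ 2))) := by
    refine Measurable.indicator ?_ (measurableSet_lt measurable_fst (hWm.comp measurable_snd))
    exact ((measurable_fst.pow_const _).const_mul _).ennreal_ofReal.mul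
      (((hfm.comp measurable_snd).norm.pow_const 2).ennreal_ofReal)
  -- The inner integral after Tonelli: at fixed `ξ` only the levels `t < W ξ` contribute, and they
  -- build up the weight `W ξ ^ q`.
  have hinner : ∀ ξ, ∫⁻ t in Set.Ioi (0 : ℝ), {z : ℝ × Space N | z.1 < W z.2}.indicator
        (fun z => ENNReal.ofReal (4 * z.1 ^ (q - 1)) * ENNReal.ofReal (‖f z.2‖ ^ 2)) (t, ξ) =
      ENNReal.ofReal (4 / q * a ^ q * (‖ξ‖ ^ 4 * ‖f ξ‖ ^ 2)) := by
    intro ξ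
    have e1 : ∀ t, {z : ℝ × Space N | z.1 < W z.2}.indicator
        (fun z => ENNReal.ofReal (4 * z.1 ^ (q - 1)) * ENNReal.ofReal (‖f z.2‖ ^ 2)) (t, ξ) =
        (Set.Iio (W ξ)).indicator (fun t => ENNReal.ofReal (4 * t ^ (q - 1))) t *
          ENNReal.ofReal (‖f ξ‖ ^ 2) := by
      intro t
      by_cases h : t < W ξ <;> simp [h, Set.indicator]
    simp_rw [e1]
    rw [lintegral_mul_const' _ _ ENNReal.ofReal_ne_top, lintegral_indicator measurableSet_Iio,
      Measure.restrict_restrict measurableSet_Iio, Set.inter_comm, Set.Ioi_inter_Iio,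
      lintegral_rpow_Ioo hq0 (hW0 ξ), ← ENNReal.ofReal_mul (by have := hW0 ξ; positivity)]
    congr 1
    rw [hW, Real.mul_rpow ha0.le (by positivity), ← Real.rpow_mul (norm_nonneg _),
      show (N : ℝ) / 2 * q = (4 : ℕ) by rw [hq]; push_cast; field_simp; norm_num,
      Real.rpow_natCast]
    ring
  have hint := integrable_norm_pow_four_mul hu
  rw [lintegral_rpow_eq_lintegral_meas_lt_mul volume (.of_forall fun x => norm_nonneg _)
    (Lp.aestronglyMeasurable u).norm.aemeasurable (by positivity)]
  calc _ ≤ ENNReal.ofReal (2 + q) * ∫⁻ t in Set.Ioi (0 : ℝ), ∫⁻ ξ,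
        {z : ℝ × Space N | z.1 < W z.2}.indicator
        (fun z => ENNReal.ofReal (4 * z.1 ^ (q - 1)) * ENNReal.ofReal (‖f z.2‖ ^ 2)) (t, ξ) := by
        gcongr 1
        exact setLIntegral_mono' measurableSet_Ioi hlevel
    _ = ENNReal.ofReal (2 + q) * ∫⁻ ξ, ENNReal.ofReal (4 / q * a ^ q * (‖ξ‖ ^ 4 * ‖f ξ‖ ^ 2)) := by
        rw [lintegral_lintegral_swap (f := fun t ξ => {z : ℝ × Space N | z.1 < W z.2}.indicator
          (fun z => ENNReal.ofReal (4 * z.1 ^ (q - 1)) * ENNReal.ofReal (‖f z.2‖ ^ 2)) (t, ξ))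
          hFm.aemeasurable]
        simp_rw [hinner]
    _ = _ := by
        rw [← ofReal_integral_eq_lintegral_ofReal (hint.const_mul _)
          (.of_forall fun ξ => by positivity), integral_const_mul,
          ← ENNReal.ofReal_mul (by positivity), ha, Real.mul_rpow (by positivity) hu0.le]
        congr 1
        ring

/-! ### Mass-preserving dilations. -/

theorem memLp_comp_smul {g : Space N → ℂ} (hg : MemLp g 2 volume) {r : ℝ} (hr : 0 < r) :
    MemLp (fun x => g (r • x)) 2 volume := by
  refine MemLp.comp_of_map ?_ (measurable_const_smul r).aemeasurable
  rw [Measure.map_addHaar_smul _ hr.ne']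
  exact hg.smul_measure ENNReal.ofReal_ne_top

/-- The mass-preserving dilation `r ^ (N / 2) u (r x)`. -/
def dilate {r : ℝ} (hr : 0 < r) (u : L2 N) : L2 N :=
  ((memLp_comp_smul (Lp.memLp u) hr).const_mul ((r ^ ((N : ℝ) / 2) : ℝ) : ℂ)).toLp _

theorem coeFn_dilate {r : ℝ} (hr : 0 < r) (u : L2 N) :
    dilate hr u =ᵐ[volume] fun x => ((r ^ ((N : ℝ) / 2) : ℝ) : ℂ) * u (r • x) :=
  MemLp.coeFn_toLp _

theorem rpow_half_sq {r : ℝ} (hr : 0 < r) : (r ^ ((N : ℝ) / 2)) ^ 2 = r ^ N := by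
  rw [← Real.rpow_natCast, ← Real.rpow_mul hr.le, ← Real.rpow_natCast]
  congr 1; push_cast; ring

theorem fourier_comp_smul (φ : Space N → ℂ) {r : ℝ} (hr : 0 < r) (y : Space N) :
    𝓕 (fun x => φ (r • x)) y = ((r ^ N : ℝ)⁻¹ : ℂ) * 𝓕 φ (r⁻¹ • y) := by
  rw [Real.fourier_eq, Real.fourier_eq]
  have h := Measure.integral_comp_smul_of_nonneg (volume : Measure (Space N))
    (fun v => Real.fourierChar (-inner ℝ v (r⁻¹ • y)) • φ v) r (hR := hr.le)
  rw [finrank_euclideanSpace_fin] at h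
  have e : ∀ v : Space N, inner ℝ (r • v) (r⁻¹ • y) = inner ℝ v y := by
    intro v
    rw [real_inner_smul_left, real_inner_smul_right, ← mul_assoc, mul_inv_cancel₀ hr.ne', one_mul]
  simp only [e] at h
  rw [h, Complex.real_smul]
  push_cast; rfl

theorem integral_mul_dilate {r : ℝ} (hr : 0 < r) (φ : Space N → ℂ) (u : L2 N) :
    ∫ x, φ x • dilate hr u x =
      ((r⁻¹ ^ ((N : ℝ) / 2) : ℝ) : ℂ) * ∫ x, φ (r⁻¹ • x) • u x := by
  have h := Measure.integral_comp_smul_of_nonneg (volume : Measure (Space N))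
    (fun x => φ (r⁻¹ • x) • u x) r (hR := hr.le)
  rw [finrank_euclideanSpace_fin] at h
  simp only [smul_smul, inv_mul_cancel₀ hr.ne', one_smul] at h
  have e : ∫ x, φ x • dilate hr u x =
      ((r ^ ((N : ℝ) / 2) : ℝ) : ℂ) * ∫ x, φ x • u (r • x) := by
    rw [← integral_const_mul]
    refine integral_congr_ae ?_
    filter_upwards [coeFn_dilate hr u] with x hx
    rw [hx, smul_eq_mul, smul_eq_mul]; ring
  rw [e, h, Complex.real_smul, ← mul_assoc, ← Complex.ofReal_mul]
  congr 2
  rw [← rpow_half_sq hr, Real.inv_rpow hr.le]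
  have : 0 < r ^ ((N : ℝ) / 2) := by positivity
  field_simp

/-- By duality with Schwartz functions this reduces to the classical rule `fourier_comp_smul`. The
factor `r ^ (N / 2)` makes dilations unitary, so the transform of one is again one. -/
theorem fourier_dilate {r : ℝ} (hr : 0 < r) (u : L2 N) :
    (𝓕 (dilate hr u) : L2 N) = dilate (inv_pos.2 hr) (𝓕 u) := by
  apply toDist_injective
  ext φ
  rw [toDist, ← Lp.fourier_toTemperedDistribution_eq, TemperedDistribution.fourier_apply, toDist,
    Lp.toTemperedDistribution_apply, Lp.toTemperedDistribution_apply, integral_mul_dilate,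
    integral_mul_dilate]
  simp only [inv_inv]
  let ψ : 𝓢(Space N, ℂ) := SchwartzMap.compCLMOfContinuousLinearEquiv ℂ
    (ContinuousLinearEquiv.smulLeft (Units.mk0 r hr.ne') : Space N ≃L[ℝ] Space N) φ
  have hψ : ∀ x, ψ x = φ (r • x) := fun x => rfl
  have h1 := DFunLike.congr_fun (Lp.fourier_toTemperedDistribution_eq u) ψ
  rw [TemperedDistribution.fourier_apply, Lp.toTemperedDistribution_apply, Lp.toTemperedDistribution_apply] at h1
  simp only [hψ] at h1
  rw [← h1, SchwartzMap.fourier_coe, SchwartzMap.fourier_coe]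
  have h2 : ∀ y, 𝓕 (ψ : Space N → ℂ) y = ((r ^ N : ℝ)⁻¹ : ℂ) * 𝓕 (φ : Space N → ℂ) (r⁻¹ • y) :=
    fun y => fourier_comp_smul φ hr y
  simp only [h2, smul_eq_mul, mul_assoc]
  rw [integral_const_mul, ← mul_assoc]
  congr 1
  rw [← Complex.ofReal_inv, ← Complex.ofReal_mul, ← rpow_half_sq hr, Real.inv_rpow hr.le]
  congr 1
  have : 0 < r ^ ((N : ℝ) / 2) := by positivity
  field_simp

/-- One change of variables serves the mass (`w = 1`), the gradient (`w = ‖ξ‖ ^ 2`) and the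
Laplacian (`w = ‖ξ‖ ^ 4`). -/
theorem integral_weight_dilate {r : ℝ} (hr : 0 < r) (w : Space N → ℝ) (u : L2 N) :
    ∫ x, w x * ‖dilate hr u x‖ ^ 2 = ∫ x, w (r⁻¹ • x) * ‖u x‖ ^ 2 := by
  have h := Measure.integral_comp_smul_of_nonneg (volume : Measure (Space N))
    (fun x => w (r⁻¹ • x) * ‖u x‖ ^ 2) r (hR := hr.le)
  rw [finrank_euclideanSpace_fin] at h
  simp only [smul_smul, inv_mul_cancel₀ hr.ne', one_smul] at h
  have e : ∫ x, w x * ‖dilate hr u x‖ ^ 2 = r ^ N * ∫ x, w x * ‖u (r • x)‖ ^ 2 := by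
    rw [← integral_const_mul]
    refine integral_congr_ae ?_
    filter_upwards [coeFn_dilate hr u] with x hx
    rw [hx, norm_mul, mul_pow, Complex.norm_real, Real.norm_eq_abs, sq_abs, rpow_half_sq hr]
    ring
  rw [e, h, smul_eq_mul, mul_inv_cancel_left₀ (by positivity)]

theorem norm_dilate {r : ℝ} (hr : 0 < r) (u : L2 N) : ‖dilate hr u‖ = ‖u‖ := by
  have h := integral_weight_dilate hr (fun _ => 1) u
  simp only [one_mul, ← norm_sq_eq_integral] at h
  exact (pow_left_inj₀ (norm_nonneg _) (norm_nonneg _) two_ne_zero).1 h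

theorem dilate_mem_H2 {r : ℝ} (hr : 0 < r) {u : L2 N} (hu : u ∈ H2 N) : dilate hr u ∈ H2 N := by
  rw [mem_H2_iff] at *
  rw [fourier_dilate]
  have h := (memLp_comp_smul hu (inv_pos.2 hr)).const_mul
    (((r⁻¹ ^ ((N : ℝ) / 2) : ℝ) : ℂ) * ((1 + r ^ 2 : ℝ) : ℂ))
  refine h.mono ?_ ?_
  · exact (Continuous.aestronglyMeasurable (by fun_prop)).mul (Lp.aestronglyMeasurable _)
  · filter_upwards [coeFn_dilate (inv_pos.2 hr) (𝓕 u : L2 N)] with ξ hξ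
    rw [hξ]
    simp only [norm_mul, Complex.norm_real]
    -- The constant `1 + r ^ 2` covers both `r ≤ 1` and `r ≥ 1`.
    have h1 : ‖1 + ‖ξ‖ ^ 2‖ ≤ ‖1 + r ^ 2‖ * ‖1 + ‖r⁻¹ • ξ‖ ^ 2‖ := by
      rw [Real.norm_of_nonneg (by positivity), Real.norm_of_nonneg (by positivity),
        Real.norm_of_nonneg (by positivity), norm_smul, mul_pow, norm_inv, Real.norm_of_nonneg hr.le]
      have : (1 + r ^ 2) * (1 + r⁻¹ ^ 2 * ‖ξ‖ ^ 2) =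
        1 + ‖ξ‖ ^ 2 + (r ^ 2 + r⁻¹ ^ 2 * ‖ξ‖ ^ 2) := by field_simp; ring
      rw [this]
      have : 0 ≤ r ^ 2 + r⁻¹ ^ 2 * ‖ξ‖ ^ 2 := by positivity
      linarith
    calc _ ≤ (‖1 + r ^ 2‖ * ‖1 + ‖r⁻¹ • ξ‖ ^ 2‖) *
          (‖r⁻¹ ^ ((N : ℝ) / 2)‖ * ‖(𝓕 u : L2 N) (r⁻¹ • ξ)‖) := by gcongr
      _ = _ := by ring

theorem norm_lap_dilate_sq {r : ℝ} (hr : 0 < r) {u : L2 N} (hu : u ∈ H2 N) :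
    ‖lap (dilate hr u)‖ ^ 2 = r ^ 4 * ‖lap u‖ ^ 2 := by
  rw [norm_lap_sq (dilate_mem_H2 hr hu), norm_lap_sq hu, fourier_dilate,
    integral_weight_dilate _ (fun ξ => ‖ξ‖ ^ 4)]
  simp only [inv_inv, norm_smul, mul_pow, Real.norm_of_nonneg hr.le, mul_assoc]
  rw [integral_const_mul]
  ring

theorem integral_gradSq_dilate {r : ℝ} (hr : 0 < r) {u : L2 N} (hu : u ∈ H2 N) :
    ∫ x, gradSq (dilate hr u) x = r ^ 2 * ∫ x, gradSq u x := by
  rw [integral_gradSq (dilate_mem_H2 hr hu), integral_gradSq hu, fourier_dilate,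
    integral_weight_dilate _ (fun ξ => ‖ξ‖ ^ 2)]
  simp only [inv_inv, norm_smul, mul_pow, Real.norm_of_nonneg hr.le, mul_assoc]
  rw [integral_const_mul]
  ring

/-- Mass criticality: the amplitude contributes `r ^ (N + 4)` and the Jacobian `r ^ (-N)`, leaving
the same power as for `‖Δu‖²`. -/
theorem integral_rpow_dilate (hN : 1 ≤ N) {r : ℝ} (hr : 0 < r) (u : L2 N) :
    ∫ x, ‖dilate hr u x‖ ^ (2 + 8 / N : ℝ) = r ^ 4 * ∫ x, ‖u x‖ ^ (2 + 8 / N : ℝ) := by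
  have hN' : (0 : ℝ) < N := by exact_mod_cast hN
  have h := Measure.integral_comp_smul_of_nonneg (volume : Measure (Space N))
    (fun x => ‖u x‖ ^ (2 + 8 / N : ℝ)) r (hR := hr.le)
  rw [finrank_euclideanSpace_fin] at h
  have e : ∫ x, ‖dilate hr u x‖ ^ (2 + 8 / N : ℝ) =
      r ^ (N + 4) * ∫ x, ‖u (r • x)‖ ^ (2 + 8 / N : ℝ) := by
    rw [← integral_const_mul]
    refine integral_congr_ae ?_
    filter_upwards [coeFn_dilate hr u] with x hx
    rw [hx, norm_mul, Complex.norm_real, Real.norm_of_nonneg (by positivity),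
      Real.mul_rpow (by positivity) (norm_nonneg _), ← Real.rpow_mul hr.le,
      ← Real.rpow_natCast r (N + 4)]
    congr 2
    push_cast; field_simp; ring
  rw [e, h, smul_eq_mul, ← mul_assoc, pow_add]
  congr 1
  field_simp

/-! ### The best Gagliardo-Nirenberg constant. -/

theorem integrable_rpow (hN : 1 ≤ N) {u : L2 N} (hu : u ∈ H2 N) :
    Integrable (fun x => ‖u x‖ ^ (2 + 8 / N : ℝ)) volume := by
  obtain ⟨C, -, hC⟩ := gagliardo_nirenberg_fourier hN
  refine ⟨((Lp.stronglyMeasurable u).measurable.norm.pow_const _).aestronglyMeasurable, ?_⟩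
  rw [hasFiniteIntegral_iff_ofReal (.of_forall fun x => by positivity)]
  exact (hC u hu).trans_lt ENNReal.ofReal_lt_top

theorem memLp_of_mem_H2 (hN : 1 ≤ N) {u : L2 N} (hu : u ∈ H2 N) :
    MemLp u (ENNReal.ofReal (2 + 8 / N : ℝ)) volume := by
  have hp : (0 : ℝ) < 2 + 8 / N := by positivity
  rw [← integrable_norm_rpow_iff (Lp.aestronglyMeasurable u) (by simpa using hp)
    ENNReal.ofReal_ne_top, ENNReal.toReal_ofReal hp.le]
  exact integrable_rpow hN hu

/-- At `σ = 4 / N` the exponents become `2` and `8 / N`, and the integrability clause holds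
automatically on `H²`. -/
theorem mem_gnConstants_iff (hN : 1 ≤ N) {B : ℝ} :
    B ∈ gnConstants N (4 / N) ↔ ∀ u ∈ H2 N, ∫ x, ‖u x‖ ^ (2 + 8 / N : ℝ) ≤
      B * (‖lap u‖ ^ 2 * ‖u‖ ^ (8 / N : ℝ)) := by
  have hN' : (0 : ℝ) < N := by exact_mod_cast hN
  have e1 : (2 * (4 / N) + 2 : ℝ) = 2 + 8 / N := by ring
  have e2 : (4 / N * N / 2 : ℝ) = (2 : ℕ) := by field_simp; norm_num
  have e3 : (2 + 2 * (4 / N) - (2 : ℕ) : ℝ) = 8 / N := by push_cast; ring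
  simp only [gnConstants, Set.mem_ofPred_eq, e1, e2, e3, Real.rpow_natCast, mul_assoc]
  exact forall₂_congr fun u hu => and_iff_right (memLp_of_mem_H2 hN hu)

theorem gnConstants_nonempty (hN : 1 ≤ N) : (gnConstants N (4 / N)).Nonempty := by
  obtain ⟨C, hC0, hC⟩ := gagliardo_nirenberg_fourier hN
  refine ⟨C / (2 * Real.pi) ^ 4, (mem_gnConstants_iff hN).2 fun u hu => ?_⟩
  have h := hC u hu
  rw [← ofReal_integral_eq_lintegral_ofReal (integrable_rpow hN hu)
    (.of_forall fun x => by positivity), ENNReal.ofReal_le_ofReal_iff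
    (mul_nonneg (by positivity) (integral_nonneg fun ξ => by positivity))] at h
  rw [norm_lap_sq hu]
  refine h.trans (le_of_eq ?_)
  have := Real.pi_pos
  field_simp

theorem smul_mem_H2 (a : ℂ) {u : L2 N} (hu : u ∈ H2 N) : a • u ∈ H2 N := by
  have h := MemSobolev.smul a hu
  rw [toDist, ← Lp.toTemperedDistributionCLM_apply, ← map_smul] at h
  exact h

theorem lap_smul (a : ℂ) {u : L2 N} (hu : u ∈ H2 N) : lap (a • u) = a • lap u := by
  apply toDist_injective
  rw [toDist_lap (smul_mem_H2 a hu), toDist, toDist, ← Lp.toTemperedDistributionCLM_apply,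
    ← Lp.toTemperedDistributionCLM_apply, map_smul, map_smul, Lp.toTemperedDistributionCLM_apply,
    Lp.toTemperedDistributionCLM_apply, ← toDist, ← toDist, toDist_lap hu,
    ← laplacianCLM_apply, ← laplacianCLM_apply, map_smul]

theorem integral_rpow_smul (p : ℝ) (a : ℂ) (u : L2 N) :
    ∫ x, ‖(a • u : L2 N) x‖ ^ p = ‖a‖ ^ p * ∫ x, ‖u x‖ ^ p := by
  rw [← integral_const_mul]
  refine integral_congr_ae ?_
  filter_upwards [Lp.coeFn_smul a u] with x hx
  rw [hx, Pi.smul_apply, norm_smul, Real.mul_rpow (norm_nonneg _) (norm_nonneg _)]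

/-- The inverse transform of the indicator of a ball: bounded frequencies make the weight harmless.
-/
theorem exists_mem_H2_ne_zero : ∃ u ∈ H2 N, u ≠ 0 := by
  set f : L2 N := indicatorConstLp 2 (μ := (volume : Measure (Space N)))
    (s := Metric.closedBall 0 1) measurableSet_closedBall measure_closedBall_lt_top.ne (1 : ℂ)
    with hf
  refine ⟨𝓕⁻ f, mem_H2_of_memLp ?_, fun h0 => ?_⟩
  · rw [fourier_fourierInv_eq]
    refine (Lp.memLp f).mono
      ((Continuous.aestronglyMeasurable (by fun_prop)).mul (Lp.aestronglyMeasurable _)) ?_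
    filter_upwards [indicatorConstLp_coeFn (p := 2) (μ := (volume : Measure (Space N)))
      (s := Metric.closedBall 0 1) (hs := measurableSet_closedBall)
      (hμs := measure_closedBall_lt_top.ne) (c := (1 : ℂ))] with ξ hξ
    rw [hξ, norm_mul, Complex.norm_real]
    by_cases h : ξ ∈ Metric.closedBall (0 : Space N) 1
    · rw [mem_closedBall_zero_iff] at h
      refine mul_le_of_le_one_left (norm_nonneg _) ?_
      rw [Real.norm_of_nonneg (by positivity)]
      exact pow_le_one₀ (norm_nonneg _) h
    · simp [h]
  · have h1 : ‖f‖ = 0 := by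
      rw [← fourier_fourierInv_eq (F := L2 N) f, h0, Lp.norm_fourier_eq, norm_zero]
    rw [hf, norm_indicatorConstLp (by norm_num) (by norm_num)] at h1
    have : 0 < volume.real (Metric.closedBall (0 : Space N) 1) := ENNReal.toReal_pos
      (Metric.measure_closedBall_pos _ _ one_pos).ne' measure_closedBall_lt_top.ne
    simp at h1
    exact this.ne' h1

theorem integral_weight_pos (hN : 1 ≤ N) {k : ℕ} {u : L2 N} (hne : u ≠ 0)
    (hint : Integrable (fun ξ => ‖ξ‖ ^ k * ‖(𝓕 u : L2 N) ξ‖ ^ 2) volume) :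
    0 < ∫ ξ, ‖ξ‖ ^ k * ‖(𝓕 u : L2 N) ξ‖ ^ 2 := by
  -- Positive dimension makes the origin, where the weight may vanish, a null set.
  have : Nonempty (Fin N) := ⟨⟨0, hN⟩⟩
  refine lt_of_le_of_ne (integral_nonneg fun ξ => by positivity) fun h => hne ?_
  have h1 := (integral_eq_zero_iff_of_nonneg (fun ξ => by positivity) hint).1 h.symm
  have h2 : ∀ᵐ ξ : Space N, ξ ≠ 0 := by
    simp [ae_iff]
  have h3 : (𝓕 u : L2 N) = 0 := by
    rw [Lp.eq_zero_iff_ae_eq_zero]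
    filter_upwards [h1, h2] with ξ h1 h2
    simpa [h2] using h1
  rw [← norm_eq_zero, ← Lp.norm_fourier_eq, h3, norm_zero]

theorem integral_gradSq_pos (hN : 1 ≤ N) {u : L2 N} (hu : u ∈ H2 N) (hne : u ≠ 0) :
    0 < ∫ x, gradSq u x := by
  rw [integral_gradSq hu]
  have := integral_weight_pos hN hne (integrable_norm_sq_mul hu)
  have := Real.pi_pos
  positivity

theorem norm_lap_pos (hN : 1 ≤ N) {u : L2 N} (hu : u ∈ H2 N) (hne : u ≠ 0) : 0 < ‖lap u‖ := by
  have h1 := integral_weight_pos hN hne (integrable_norm_pow_four_mul hu)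
  have h2 : 0 < ‖lap u‖ ^ 2 := by
    rw [norm_lap_sq hu]
    have := Real.pi_pos
    positivity
  exact lt_of_le_of_ne (norm_nonneg _) fun h => by simp [← h] at h2

theorem integral_rpow_pos (hN : 1 ≤ N) {u : L2 N} (hu : u ∈ H2 N) (hne : u ≠ 0) :
    0 < ∫ x, ‖u x‖ ^ (2 + 8 / N : ℝ) := by
  refine lt_of_le_of_ne (integral_nonneg fun x => by positivity) fun h => hne ?_
  have h1 := (integral_eq_zero_iff_of_nonneg (fun x => by positivity)
    (integrable_rpow hN hu)).1 h.symm
  rw [Lp.eq_zero_iff_ae_eq_zero]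
  filter_upwards [h1] with x h1
  have hp : (2 + 8 / N : ℝ) ≠ 0 := by positivity
  simpa [Real.rpow_eq_zero (norm_nonneg _) hp] using h1

theorem gnConstants_pos (hN : 1 ≤ N) {B : ℝ} (hB : B ∈ gnConstants N (4 / N)) : 0 < B := by
  obtain ⟨u, hu, hne⟩ := exists_mem_H2_ne_zero (N := N)
  have h := (integral_rpow_pos hN hu hne).trans_le ((mem_gnConstants_iff hN).1 hB u hu)
  exact pos_of_mul_pos_left h (by positivity)

/-- For each `u` the condition on `B` is closed, so it passes to the infimum; positivity of
admissible constants supplies the lower bound. -/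
theorem gnBest_isLeast (hN : 1 ≤ N) : IsLeast (gnConstants N (4 / N)) (gnBest N (4 / N)) := by
  have hbdd : BddBelow (gnConstants N (4 / N)) := ⟨0, fun B hB => (gnConstants_pos hN hB).le⟩
  refine ⟨(mem_gnConstants_iff hN).2 fun u hu => ?_, fun B hB => csInf_le hbdd hB⟩
  rcases eq_or_ne u 0 with rfl | hne
  · obtain ⟨B, hB⟩ := gnConstants_nonempty hN
    refine ((mem_gnConstants_iff hN).1 hB 0 hu).trans (le_of_eq ?_)
    have hN' : (8 / N : ℝ) ≠ 0 := by positivity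
    simp [Real.zero_rpow hN']
  · have hX : 0 < ‖lap u‖ ^ 2 * ‖u‖ ^ (8 / N : ℝ) :=
      mul_pos (pow_pos (norm_lap_pos hN hu hne) 2) (Real.rpow_pos_of_pos (norm_pos_iff.2 hne) _)
    rw [← div_le_iff₀ hX]
    refine le_csInf (gnConstants_nonempty hN) fun B hB => ?_
    rw [div_le_iff₀ hX]
    exact (mem_gnConstants_iff hN).1 hB u hu

theorem gnBest_pos (hN : 1 ≤ N) : 0 < gnBest N (4 / N) := gnConstants_pos hN (gnBest_isLeast hN).1

/-! ### A lower bound on the gradient. -/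

theorem add_rpow_le {a b p : ℝ} (ha : 0 ≤ a) (hb : 0 ≤ b) (hp : 0 ≤ p) :
    (a + b) ^ p ≤ 2 ^ p * (a ^ p + b ^ p) := by
  have ha' := Real.rpow_nonneg ha p
  have hb' := Real.rpow_nonneg hb p
  rcases le_total a b with h | h
  · calc (a + b) ^ p ≤ (2 * b) ^ p := Real.rpow_le_rpow (by positivity) (by linarith) hp
      _ = 2 ^ p * b ^ p := Real.mul_rpow (by norm_num) hb
      _ ≤ _ := by gcongr; linarith
  · calc (a + b) ^ p ≤ (2 * a) ^ p := Real.rpow_le_rpow (by positivity) (by linarith) hp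
      _ = 2 ^ p * a ^ p := Real.mul_rpow (by norm_num) ha
      _ ≤ _ := by gcongr; linarith

theorem norm_freqCut_sq {s : Set (Space N)} (hs : MeasurableSet s) (u : L2 N) :
    ‖freqCut hs u‖ ^ 2 = ∫ ξ in s, ‖(𝓕 u : L2 N) ξ‖ ^ 2 := by
  rw [← Lp.norm_fourier_eq, norm_sq_eq_integral, integral_congr_ae (norm_fourier_freqCut_sq hs u),
    integral_indicator hs]

theorem norm_lap_freqCut_sq {s : Set (Space N)} (hs : MeasurableSet s) {u : L2 N}
    (hu : u ∈ H2 N) : ‖lap (freqCut hs u)‖ ^ 2 =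
      (2 * Real.pi) ^ 4 * ∫ ξ in s, ‖ξ‖ ^ 4 * ‖(𝓕 u : L2 N) ξ‖ ^ 2 := by
  rw [norm_lap_sq (freqCut_mem_H2 hs hu), ← integral_indicator hs]
  congr 1
  refine integral_congr_ae ?_
  filter_upwards [norm_fourier_freqCut_sq hs u] with ξ hξ
  rw [hξ]
  by_cases h : ξ ∈ s <;> simp [h]

/-- A Gagliardo-Nirenberg inequality whose right-hand side is small when the gradient is. -/
theorem exists_integral_rpow_le (hN : 1 ≤ N) : ∃ K : ℝ, ∀ u ∈ H2 N,
    ∫ x, ‖u x‖ ^ (2 + 8 / N : ℝ) ≤ K * ((∫ x, gradSq u x) * ‖u‖ ^ (8 / N : ℝ) +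
      ‖lap u‖ ^ 2 * (∫ x, gradSq u x) ^ (4 / N : ℝ)) := by
  have hπ : 1 ≤ 2 * Real.pi := by linarith [Real.pi_gt_three]
  set B := gnBest N (4 / N)
  have hB : 0 < B := gnBest_pos hN
  set p : ℝ := 2 + 8 / N with hp
  have hp0 : 0 < p := by positivity
  refine ⟨2 ^ p * (B * (2 * Real.pi) ^ 2), fun u hu => ?_⟩
  set G := ∫ x, gradSq u x with hG
  have hGF := integral_gradSq hu
  have hG0 : 0 ≤ G := by rw [hG, hGF]; positivity
  have hs : MeasurableSet (Metric.closedBall (0 : Space N) 1) := measurableSet_closedBall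
  set v := freqCut hs u with hv
  set w := freqCut hs.compl u with hw
  have hvH : v ∈ H2 N := freqCut_mem_H2 hs hu
  have hwH : w ∈ H2 N := freqCut_mem_H2 hs.compl hu
  have hgn := (mem_gnConstants_iff hN).1 (gnBest_isLeast hN).1
  have i4 := integrable_norm_pow_four_mul hu
  have i2 := integrable_norm_sq_mul hu
  have i0 := integrable_norm_sq (𝓕 u : L2 N)
  -- On the unit ball `‖ξ‖ ^ 4 ≤ ‖ξ‖ ^ 2`, so the gradient controls the Laplacian of the low part;
  -- outside, `1 ≤ ‖ξ‖ ^ 2`, so it controls the mass of the high part (`hwM`).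
  have hvA : ‖lap v‖ ^ 2 ≤ (2 * Real.pi) ^ 2 * G := by
    rw [hv, norm_lap_freqCut_sq hs hu, hG, hGF, ← mul_assoc, ← pow_add]
    gcongr
    refine (setIntegral_mono_on i4.integrableOn i2.integrableOn hs fun ξ hξ => ?_).trans
      (setIntegral_le_integral i2 (.of_forall fun ξ => by positivity))
    rw [mem_closedBall_zero_iff] at hξ
    exact mul_le_mul_of_nonneg_right (pow_le_pow_of_le_one (norm_nonneg _) hξ (by norm_num))
      (sq_nonneg _)
  have hwA : ‖lap w‖ ^ 2 ≤ ‖lap u‖ ^ 2 := by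
    rw [hw, norm_lap_freqCut_sq hs.compl hu, norm_lap_sq hu]
    refine mul_le_mul_of_nonneg_left ?_ (by positivity)
    exact setIntegral_le_integral i4 (.of_forall fun ξ => by positivity)
  have hvM : ‖v‖ ≤ ‖u‖ := by
    refine le_of_sq_le_sq ?_ (norm_nonneg _)
    rw [hv, norm_freqCut_sq, ← Lp.norm_fourier_eq u, norm_sq_eq_integral]
    exact setIntegral_le_integral i0 (.of_forall fun ξ => by positivity)
  have hwM : ‖w‖ ^ 2 ≤ G := by
    have h1 : ‖w‖ ^ 2 ≤ ∫ ξ, ‖ξ‖ ^ 2 * ‖(𝓕 u : L2 N) ξ‖ ^ 2 := by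
      rw [hw, norm_freqCut_sq]
      refine (setIntegral_mono_on i0.integrableOn i2.integrableOn hs.compl fun ξ hξ => ?_).trans
        (setIntegral_le_integral i2 (.of_forall fun ξ => by positivity))
      rw [Set.mem_compl_iff, mem_closedBall_zero_iff, not_le] at hξ
      exact le_mul_of_one_le_left (sq_nonneg _) (one_le_pow₀ hξ.le)
    refine h1.trans ?_
    rw [hG, hGF]
    exact le_mul_of_one_le_left (integral_nonneg fun ξ => by positivity) (one_le_pow₀ hπ)
  have hwq : ‖w‖ ^ (8 / N : ℝ) ≤ G ^ (4 / N : ℝ) := by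
    have e : ‖w‖ ^ (8 / N : ℝ) = (‖w‖ ^ 2) ^ (4 / N : ℝ) := by
      rw [← Real.rpow_natCast, ← Real.rpow_mul (norm_nonneg _)]
      congr 1; push_cast; ring
    rw [e]
    exact Real.rpow_le_rpow (sq_nonneg _) hwM (by positivity)
  have hvP : ∫ x, ‖v x‖ ^ p ≤ B * ((2 * Real.pi) ^ 2 * G * ‖u‖ ^ (8 / N : ℝ)) := by
    refine (hgn v hvH).trans ?_
    gcongr
  have hwP : ∫ x, ‖w x‖ ^ p ≤ B * ((2 * Real.pi) ^ 2 * (‖lap u‖ ^ 2 * G ^ (4 / N : ℝ))) := by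
    refine (hgn w hwH).trans ?_
    have h1 : ‖lap w‖ ^ 2 * ‖w‖ ^ (8 / N : ℝ) ≤ ‖lap u‖ ^ 2 * G ^ (4 / N : ℝ) := by gcongr
    have h2 : 0 ≤ ‖lap u‖ ^ 2 * G ^ (4 / N : ℝ) := by positivity
    have h3 := le_mul_of_one_le_left h2 (one_le_pow₀ hπ (n := 2))
    exact mul_le_mul_of_nonneg_left (h1.trans h3) hB.le
  calc ∫ x, ‖u x‖ ^ p ≤ ∫ x, 2 ^ p * (‖v x‖ ^ p + ‖w x‖ ^ p) := by
        refine integral_mono_ae (integrable_rpow hN hu)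
          (((integrable_rpow hN hvH).add (integrable_rpow hN hwH)).const_mul _) ?_
        have hadd := Lp.coeFn_add v w
        rw [hv, hw, freqCut_add_compl] at hadd
        filter_upwards [hadd] with x hx
        rw [hx, Pi.add_apply]
        exact (Real.rpow_le_rpow (norm_nonneg _) (norm_add_le _ _) hp0.le).trans
          (add_rpow_le (norm_nonneg _) (norm_nonneg _) hp0.le)
    _ = 2 ^ p * ((∫ x, ‖v x‖ ^ p) + ∫ x, ‖w x‖ ^ p) := by
        rw [integral_const_mul, integral_add (integrable_rpow hN hvH) (integrable_rpow hN hwH)]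
    _ ≤ 2 ^ p * (B * ((2 * Real.pi) ^ 2 * G * ‖u‖ ^ (8 / N : ℝ)) +
          B * ((2 * Real.pi) ^ 2 * (‖lap u‖ ^ 2 * G ^ (4 / N : ℝ)))) := by gcongr
    _ = _ := by ring

/-- With mass and Laplacian fixed, the bound of `exists_integral_rpow_le` tends to `0` with the
gradient, so a nonlinear term of size `P` forbids a small gradient. The bound `g` does not depend on
`u`. -/
theorem exists_gradient_lower_bound (hN : 1 ≤ N) (c : ℝ) {P : ℝ} (hP : 0 < P) :
    ∃ g : ℝ, 0 < g ∧ ∀ u ∈ H2 N, ‖u‖ ^ (8 / N : ℝ) = c → ‖lap u‖ ^ 2 = 1 →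
      P ≤ ∫ x, ‖u x‖ ^ (2 + 8 / N : ℝ) → g ≤ ∫ x, gradSq u x := by
  obtain ⟨K, hK⟩ := exists_integral_rpow_le hN
  have hN' : (0 : ℝ) < 4 / N := by positivity
  have hc : Continuous fun G : ℝ => K * (G * c + 1 * G ^ (4 / N : ℝ)) :=
    continuous_const.mul ((continuous_id.mul continuous_const).add
      (continuous_const.mul (Real.continuous_rpow_const hN'.le)))
  have ht := hc.tendsto 0
  rw [zero_mul, Real.zero_rpow hN'.ne', mul_zero, add_zero, mul_zero] at ht
  obtain ⟨δ, hδ, h⟩ := Metric.eventually_nhds_iff.1 (ht.eventually (gt_mem_nhds hP))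
  refine ⟨δ, hδ, fun u hu hM hA hPu => ?_⟩
  by_contra! hlt
  have hG0 : 0 ≤ ∫ x, gradSq u x := by rw [integral_gradSq hu]; positivity
  have h1 := hK u hu
  rw [hM, hA] at h1
  have h2 := h (y := ∫ x, gradSq u x) (by rwa [Real.dist_eq, sub_zero, abs_of_nonneg hG0])
  linarith

/-! ### The energy along dilations and the critical mass. -/

theorem mem_S_iff {c : ℝ} {u : L2 N} : u ∈ S N c ↔ u ∈ H2 N ∧ ‖u‖ ^ 2 = c := by
  rw [S, Set.mem_ofPred_eq, norm_sq_eq_integral]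

theorem norm_rpow_of_sq_eq {u : L2 N} {c : ℝ} (h : ‖u‖ ^ 2 = c) :
    ‖u‖ ^ (8 / N : ℝ) = c ^ (4 / N : ℝ) := by
  rw [← h, ← Real.rpow_natCast, ← Real.rpow_mul (norm_nonneg _)]
  congr 1; push_cast; ring

theorem energy_eq (γ β α : ℝ) (u : L2 N) :
    energy γ β α (4 / N) u = γ / 2 * ‖lap u‖ ^ 2 - β / 2 * (∫ x, gradSq u x)
      - α / (2 + 8 / N) * ∫ x, ‖u x‖ ^ (2 + 8 / N : ℝ) := by
  rw [energy, norm_sq_eq_integral, show (2 * (4 / N) + 2 : ℝ) = 2 + 8 / N by ring]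

theorem energy_dilate (hN : 1 ≤ N) (γ β α : ℝ) {r : ℝ} (hr : 0 < r) {u : L2 N} (hu : u ∈ H2 N) :
    energy γ β α (4 / N) (dilate hr u) =
      r ^ 4 * (γ / 2 * ‖lap u‖ ^ 2 - α / (2 + 8 / N) * ∫ x, ‖u x‖ ^ (2 + 8 / N : ℝ))
        - r ^ 2 * (β / 2 * ∫ x, gradSq u x) := by
  rw [energy_eq, norm_lap_dilate_sq hr hu, integral_gradSq_dilate hr hu,
    integral_rpow_dilate hN hr]
  ring

theorem dilate_mem_S {r c : ℝ} (hr : 0 < r) {u : L2 N} (hu : u ∈ S N c) : dilate hr u ∈ S N c := by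
  rw [mem_S_iff] at *
  exact ⟨dilate_mem_H2 hr hu.1, by rw [norm_dilate, hu.2]⟩

/-- Multiplication by a constant and dilation normalize the mass and the Laplacian, and preserve
the Gagliardo-Nirenberg quotient. -/
theorem exists_normalized (hN : 1 ≤ N) {u : L2 N} (hu : u ∈ H2 N) (hne : u ≠ 0) {c : ℝ}
    (hc : 0 < c) : ∃ v ∈ S N c, ‖lap v‖ ^ 2 = 1 ∧
      (∫ x, ‖v x‖ ^ (2 + 8 / N : ℝ)) * (‖lap u‖ ^ 2 * ‖u‖ ^ (8 / N : ℝ)) =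
        (∫ x, ‖u x‖ ^ (2 + 8 / N : ℝ)) * c ^ (4 / N : ℝ) := by
  have hu0 : 0 < ‖u‖ := norm_pos_iff.2 hne
  have hl : 0 < ‖lap u‖ := norm_lap_pos hN hu hne
  -- Two free parameters for two constraints: `a` fixes the mass, then `r` solves `r ^ 4 * a ^ 2 *
  -- ‖lap u‖ ^ 2 = 1`.
  set a : ℝ := Real.sqrt c / ‖u‖ with ha
  have ha0 : 0 < a := by positivity
  have hna : ‖(a : ℂ)‖ = a := by rw [Complex.norm_real, Real.norm_of_nonneg ha0.le]
  set r : ℝ := Real.sqrt (1 / (a * ‖lap u‖)) with hr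
  have hr0 : 0 < r := Real.sqrt_pos.2 (by positivity)
  have hr4 : r ^ 4 * (a ^ 2 * ‖lap u‖ ^ 2) = 1 := by
    rw [show r ^ 4 = (r ^ 2) ^ 2 by ring, hr, Real.sq_sqrt (by positivity)]
    field_simp
  have hau : (a : ℂ) • u ∈ H2 N := smul_mem_H2 _ hu
  have hmass : ‖dilate hr0 ((a : ℂ) • u)‖ ^ 2 = c := by
    rw [norm_dilate, norm_smul, hna, ha, div_mul_cancel₀ _ hu0.ne', Real.sq_sqrt hc.le]
  have haq : a ^ (8 / N : ℝ) * ‖u‖ ^ (8 / N : ℝ) = c ^ (4 / N : ℝ) := by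
    rw [← norm_rpow_of_sq_eq hmass, norm_dilate, norm_smul, hna,
      Real.mul_rpow ha0.le hu0.le]
  refine ⟨dilate hr0 ((a : ℂ) • u), mem_S_iff.2 ⟨dilate_mem_H2 hr0 hau, hmass⟩, ?_, ?_⟩
  · rw [norm_lap_dilate_sq hr0 hau, lap_smul _ hu, norm_smul, hna, mul_pow, hr4]
  · rw [integral_rpow_dilate hN hr0, integral_rpow_smul, hna, Real.rpow_add ha0, Real.rpow_two,
      ← haq]
    linear_combination (a ^ (8 / N : ℝ) * ‖u‖ ^ (8 / N : ℝ) *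
      ∫ x, ‖u x‖ ^ (2 + 8 / N : ℝ)) * hr4

theorem cStar_base_pos (hN : 1 ≤ N) {γ α : ℝ} (hγ : 0 < γ) (hα : 0 < α) :
    0 < γ / α * (((N : ℝ) + 4) / (N * gnBest N (4 / N))) := by
  have hN' : (0 : ℝ) < N := by exact_mod_cast hN
  have := gnBest_pos hN
  positivity

/-- The critical mass is where the coefficient of `‖Δu‖²`, after the Gagliardo-Nirenberg bound,
changes sign. -/
theorem lt_cStar_iff (hN : 1 ≤ N) {γ α : ℝ} (hγ : 0 < γ) (hα : 0 < α) {c : ℝ} (hc : 0 < c) :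
    c < cStar N γ α ↔ α / (2 + 8 / N) * (gnBest N (4 / N) * c ^ (4 / N : ℝ)) < γ / 2 := by
  have hN' : (0 : ℝ) < N := by exact_mod_cast hN
  have hB := gnBest_pos hN
  have hX := cStar_base_pos hN hγ hα
  have e : c = (c ^ (4 / N : ℝ)) ^ ((N : ℝ) / 4) := by
    rw [← Real.rpow_mul hc.le, show (4 / N * (N / 4) : ℝ) = 1 by field_simp, Real.rpow_one]
  conv_lhs => rw [cStar, e]
  rw [Real.rpow_lt_rpow_iff (by positivity) hX.le (by positivity)]
  generalize c ^ (4 / N : ℝ) = y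
  rw [show α / (2 + 8 / N) * (gnBest N (4 / N) * y) =
      y * (α * N * gnBest N (4 / N) / (2 * (N + 4))) by field_simp; ring,
    ← lt_div_iff₀ (by positivity)]
  refine iff_of_eq (congrArg _ ?_)
  field_simp

theorem exists_mem_S (hN : 1 ≤ N) {c : ℝ} (hc : 0 < c) : ∃ u ∈ S N c, u ≠ 0 := by
  obtain ⟨u, hu, hne⟩ := exists_mem_H2_ne_zero (N := N)
  obtain ⟨v, hv, -⟩ := exists_normalized hN hu hne hc
  refine ⟨v, hv, fun h => ?_⟩
  have := (mem_S_iff.1 hv).2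
  rw [h, norm_zero] at this
  norm_num at this
  exact hc.ne this

/-! ### Boundedness below, coercivity and negativity of the infimum. -/

theorem integral_gradSq_le {u : L2 N} (hu : u ∈ H2 N) {ε : ℝ} (hε : 0 < ε) :
    ∫ x, gradSq u x ≤ ε * ‖lap u‖ ^ 2 + 1 / (4 * ε) * ‖u‖ ^ 2 := by
  rw [integral_gradSq hu, norm_lap_sq hu, ← Lp.norm_fourier_eq u, norm_sq_eq_integral,
    ← integral_const_mul, ← integral_const_mul, ← integral_const_mul, ← integral_const_mul,
    ← integral_add (((integrable_norm_pow_four_mul hu).const_mul _).const_mul _)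
      ((integrable_norm_sq _).const_mul _)]
  refine integral_mono ((integrable_norm_sq_mul hu).const_mul _)
    ((((integrable_norm_pow_four_mul hu).const_mul _).const_mul _).add
      ((integrable_norm_sq _).const_mul _)) fun ξ => ?_
  have h : (2 * Real.pi) ^ 2 * ‖ξ‖ ^ 2 ≤ ε * ((2 * Real.pi) ^ 4 * ‖ξ‖ ^ 4) + 1 / (4 * ε) := by
    have h1 : ε * ((2 * Real.pi) ^ 4 * ‖ξ‖ ^ 4) + 1 / (4 * ε) - (2 * Real.pi) ^ 2 * ‖ξ‖ ^ 2 =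
        ε * ((2 * Real.pi) ^ 2 * ‖ξ‖ ^ 2 - 1 / (2 * ε)) ^ 2 := by field_simp; ring
    have h2 : 0 ≤ ε * ((2 * Real.pi) ^ 2 * ‖ξ‖ ^ 2 - 1 / (2 * ε)) ^ 2 := by positivity
    linarith
  have := mul_le_mul_of_nonneg_right h (sq_nonneg ‖(𝓕 u : L2 N) ξ‖)
  simp only
  linarith

theorem h2Norm_eq (u : L2 N) :
    h2Norm u = Real.sqrt (‖lap u‖ ^ 2 + (∫ x, gradSq u x) + ‖u‖ ^ 2) := by
  rw [h2Norm, integral_add (f := fun x => ‖lap u x‖ ^ 2 + gradSq u x)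
    ((integrable_norm_sq _).add (integrable_gradSq u))
    (integrable_norm_sq _), integral_add (integrable_norm_sq _) (integrable_gradSq u),
    norm_sq_eq_integral, norm_sq_eq_integral]

/-- Below the critical mass the energy controls the Laplacian. -/
theorem exists_energy_ge (hN : 1 ≤ N) {γ β α : ℝ} (hγ : 0 < γ) (hβ : 0 < β) (hα : 0 < α) {c : ℝ}
    (hc : 0 < c) (hcs : c < cStar N γ α) :
    ∃ κ > 0, ∃ D : ℝ, ∀ u ∈ S N c, κ * ‖lap u‖ ^ 2 - D ≤ energy γ β α (4 / N) u := by
  rw [lt_cStar_iff hN hγ hα hc] at hcs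
  set κ := γ / 2 - α / (2 + 8 / N) * (gnBest N (4 / N) * c ^ (4 / N : ℝ)) with hκ
  have hκ0 : 0 < κ := sub_pos.2 hcs
  -- Interpolation with `ε = κ / β` spends half of `κ` on the gradient term.
  refine ⟨κ / 2, by positivity, β / 2 * (1 / (4 * (κ / β)) * c), fun u hu => ?_⟩
  rw [mem_S_iff] at hu
  rw [energy_eq]
  have h1 := (mem_gnConstants_iff hN).1 (gnBest_isLeast hN).1 u hu.1
  rw [norm_rpow_of_sq_eq hu.2] at h1
  have h2 := integral_gradSq_le hu.1 (show 0 < κ / β by positivity)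
  rw [hu.2] at h2
  have hd : 0 < α / (2 + 8 / N : ℝ) := by positivity
  have h3 := mul_le_mul_of_nonneg_left h1 hd.le
  have h4 := mul_le_mul_of_nonneg_left h2 (show 0 ≤ β / 2 by positivity)
  have h5 : β / 2 * (κ / β * ‖lap u‖ ^ 2) = κ / 2 * ‖lap u‖ ^ 2 := by field_simp
  have h6 : κ * ‖lap u‖ ^ 2 = γ / 2 * ‖lap u‖ ^ 2 -
      α / (2 + 8 / N) * (gnBest N (4 / N) * (‖lap u‖ ^ 2 * c ^ (4 / N : ℝ))) := by
    rw [hκ]; ring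
  linarith

theorem coerciveOn_energy (hN : 1 ≤ N) {γ β α : ℝ} (hγ : 0 < γ) (hβ : 0 < β) (hα : 0 < α) {c : ℝ}
    (hc : 0 < c) (hcs : c < cStar N γ α) : CoerciveOn (energy γ β α (4 / N)) (S N c) := by
  obtain ⟨κ, hκ, D, h⟩ := exists_energy_ge hN hγ hβ hα hc hcs
  intro M
  -- On `S(c)`, interpolation with `ε = 1` gives `h2Norm u ^ 2 ≤ 2 * ‖lap u‖ ^ 2 + 5 * c / 4`, so a
  -- large norm forces a large Laplacian.
  refine ⟨Real.sqrt (2 * ((|M| + |D|) / κ) + 2 * c), fun u hu hR => le_trans ?_ (h u hu)⟩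
  have hu' := mem_S_iff.1 hu
  have hG := integral_gradSq_le hu'.1 one_pos
  have hG0 : 0 ≤ ∫ x, gradSq u x := by rw [integral_gradSq hu'.1]; positivity
  rw [h2Norm_eq, Real.sqrt_le_sqrt_iff (by positivity)] at hR
  rw [hu'.2] at hR hG
  have h1 : (|M| + |D|) / κ ≤ ‖lap u‖ ^ 2 := by linarith
  rw [div_le_iff₀' hκ] at h1
  linarith [le_abs_self M, le_abs_self D]

theorem bot_lt_m (hN : 1 ≤ N) {γ β α : ℝ} (hγ : 0 < γ) (hβ : 0 < β) (hα : 0 < α) {c : ℝ}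
    (hc : 0 < c) (hcs : c < cStar N γ α) : ⊥ < m N γ β α (4 / N) c := by
  obtain ⟨κ, hκ, D, h⟩ := exists_energy_ge hN hγ hβ hα hc hcs
  refine (EReal.bot_lt_coe (-D)).trans_le (le_iInf₂ fun u hu => EReal.coe_le_coe_iff.2 ?_)
  have := h u hu
  have : 0 ≤ κ * ‖lap u‖ ^ 2 := by positivity
  linarith

theorem m_neg (hN : 1 ≤ N) (γ : ℝ) {β : ℝ} (α : ℝ) (hβ : 0 < β) {c : ℝ} (hc : 0 < c) :
    m N γ β α (4 / N) c < 0 := by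
  obtain ⟨u, hu, hne⟩ := exists_mem_S hN hc
  have hu' := mem_S_iff.1 hu
  have hG := mul_pos (half_pos hβ) (integral_gradSq_pos hN hu'.1 hne)
  set G := β / 2 * ∫ x, gradSq u x with hGdef
  set X := γ / 2 * ‖lap u‖ ^ 2 - α / (2 + 8 / N) * ∫ x, ‖u x‖ ^ (2 + 8 / N : ℝ) with hX
  -- This `r` turns `r ^ 4 * X - r ^ 2 * G` into `r ^ 4 * (X - |X| - 1)`, negative whatever the sign
  -- of `X`.
  set r := Real.sqrt (G / (|X| + 1)) with hr
  have hr0 : 0 < r := Real.sqrt_pos.2 (by positivity)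
  have hr2 : r ^ 2 * (|X| + 1) = G := by
    rw [hr, Real.sq_sqrt (by positivity)]; field_simp
  refine lt_of_le_of_lt (iInf₂_le (dilate hr0 u) (dilate_mem_S hr0 hu)) ?_
  rw [energy_dilate hN γ β α hr0 hu'.1, ← hX, ← hGdef, ← EReal.coe_zero, EReal.coe_lt_coe_iff]
  have h1 : r ^ 4 * X - r ^ 2 * G = r ^ 4 * (X - (|X| + 1)) := by rw [← hr2]; ring
  rw [h1]
  exact mul_neg_of_pos_of_neg (by positivity) (by linarith [le_abs_self X])

/-! ### Unboundedness from the critical mass on. -/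

/-- From the critical mass on, dilations of near-optimizers of the Gagliardo-Nirenberg inequality
have arbitrarily negative energy: their gradients stay bounded away from zero. -/
theorem m_eq_bot (hN : 1 ≤ N) {γ β α : ℝ} (hγ : 0 < γ) (hβ : 0 < β) (hα : 0 < α) {c : ℝ}
    (hcs : cStar N γ α ≤ c) : m N γ β α (4 / N) c = ⊥ := by
  have hc : 0 < c := (Real.rpow_pos_of_pos (cStar_base_pos hN hγ hα) _).trans_le hcs
  have hcrit := mt (lt_cStar_iff hN hγ hα hc).2 hcs.not_gt
  rw [not_lt] at hcrit
  set B := gnBest N (4 / N) with hBdef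
  have hB : 0 < B := gnBest_pos hN
  set y := c ^ (4 / N : ℝ) with hy
  have hy0 : 0 < y := by positivity
  set d := α / (2 + 8 / N : ℝ) with hd
  have hd0 : 0 < d := by positivity
  -- The order of choices matters: `g` uses only `ε ≤ B / 2`, next `r` depends on `g`, and only then
  -- is `ε` chosen small in terms of `r`. The final energy is at most `1 - (|K| + 2) < K`.
  obtain ⟨g, hg, hgl⟩ := exists_gradient_lower_bound hN y (show 0 < B / 2 * y by positivity)
  rw [EReal.eq_bot_iff_forall_lt]
  intro K
  set r := Real.sqrt ((|K| + 2) / (β / 2 * g)) with hr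
  have hr0 : 0 < r := Real.sqrt_pos.2 (by positivity)
  have hr2 : r ^ 2 * (β / 2 * g) = |K| + 2 := by
    rw [hr, Real.sq_sqrt (by positivity)]; field_simp
  set ε := min (B / 2) (1 / (r ^ 4 * d * y)) with hε
  have hε0 : 0 < ε := by positivity
  have hε1 : ε ≤ B / 2 := min_le_left _ _
  have hε2 : r ^ 4 * (d * (ε * y)) ≤ 1 := by
    have : ε ≤ 1 / (r ^ 4 * d * y) := min_le_right _ _
    rw [le_div_iff₀ (by positivity)] at this
    linarith
  -- Minimality of `B` produces the near-optimizer.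
  have hnot : B - ε ∉ gnConstants N (4 / N) := fun h => by
    have := (gnBest_isLeast hN).2 h
    linarith
  rw [mem_gnConstants_iff hN] at hnot
  push Not at hnot
  obtain ⟨u, hu, hlt⟩ := hnot
  have hne : u ≠ 0 := by
    rintro rfl
    have h1 := (mem_gnConstants_iff hN).1 (gnBest_isLeast hN).1 0 hu
    have h8 : (8 / N : ℝ) ≠ 0 := by positivity
    simp only [norm_zero, Real.zero_rpow h8, mul_zero] at h1 hlt
    linarith
  obtain ⟨v, hv, hA, hP⟩ := exists_normalized hN hu hne hc
  have hv' := mem_S_iff.1 hv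
  have hX : 0 < ‖lap u‖ ^ 2 * ‖u‖ ^ (8 / N : ℝ) :=
    mul_pos (pow_pos (norm_lap_pos hN hu hne) 2) (Real.rpow_pos_of_pos (norm_pos_iff.2 hne) _)
  have hPv : (B - ε) * y < ∫ x, ‖v x‖ ^ (2 + 8 / N : ℝ) := by
    refine lt_of_mul_lt_mul_right ?_ hX.le
    rw [hP]
    have := mul_lt_mul_of_pos_right hlt hy0
    linarith
  have hGv := hgl v hv'.1 (norm_rpow_of_sq_eq hv'.2) hA
    (le_trans (by gcongr; linarith) hPv.le)
  refine lt_of_le_of_lt (iInf₂_le (dilate hr0 v) (dilate_mem_S hr0 hv)) ?_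
  rw [energy_dilate hN γ β α hr0 hv'.1, hA, EReal.coe_lt_coe_iff, mul_one]
  -- Here `c ≥ c*` enters, as `γ / 2 ≤ d * (B * y)`; equality is allowed.
  have h1 : γ / 2 - d * (∫ x, ‖v x‖ ^ (2 + 8 / N : ℝ)) ≤ d * (ε * y) := by
    have := mul_le_mul_of_nonneg_left hPv.le hd0.le
    linarith
  have h2 := mul_le_mul_of_nonneg_left h1 (show 0 ≤ r ^ 4 by positivity)
  have h3 : r ^ 2 * (β / 2 * g) ≤ r ^ 2 * (β / 2 * ∫ x, gradSq v x) := by gcongr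
  linarith [neg_abs_le K]

end BiharmonicNLS

end

theorem lemma7p2 (N : ℕ) (hN : 1 ≤ N) (γ β α σ : ℝ) (hγ : 0 < γ) (hβ : 0 < β) (hα : 0 < α)
    (hσ : σ * N = 4) :
    IsLeast (BiharmonicNLS.gnConstants N (4 / N)) (BiharmonicNLS.gnBest N (4 / N)) ∧
    0 < BiharmonicNLS.cStar N γ α ∧
    (∀ c : ℝ, 0 < c → c < BiharmonicNLS.cStar N γ α →
      ⊥ < BiharmonicNLS.m N γ β α σ c ∧ BiharmonicNLS.m N γ β α σ c < 0 ∧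
      BiharmonicNLS.CoerciveOn (BiharmonicNLS.energy γ β α σ) (BiharmonicNLS.S N c)) ∧
    (∀ c : ℝ, BiharmonicNLS.cStar N γ α ≤ c → BiharmonicNLS.m N γ β α σ c = ⊥) := by
  have hN' : (N : ℝ) ≠ 0 := by positivity
  obtain rfl : σ = 4 / N := by rw [eq_div_iff hN', hσ]
  exact ⟨BiharmonicNLS.gnBest_isLeast hN,
    Real.rpow_pos_of_pos (BiharmonicNLS.cStar_base_pos hN hγ hα) _,
    fun c hc hcs => ⟨BiharmonicNLS.bot_lt_m hN hγ hβ hα hc hcs,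
      BiharmonicNLS.m_neg hN γ α hβ hc, BiharmonicNLS.coerciveOn_energy hN hγ hβ hα hc hcs⟩,
    fun c hcs => BiharmonicNLS.m_eq_bot hN hγ hβ hα hcs⟩
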